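/- Let $X$ be a compact Hausdorff one-dimensional topological manifold (boundary allowed, not necessarily connected), and let $\Gamma$ be a pseudogroup of homeomorphisms of $X$, i.e. a family of homeomorphisms between open subsets of $X$ which contains the identity and is closed under composition, inversion, restriction to open subsets and gluing. Let $\Lambda\subset X$ be a nonempty compact $\Gamma$-invariant set which is minimal, i.e. contains no proper nonempty compact $\Gamma$-invariant subset. Write $O(x)=\{g(x): g\in\Gamma,\ x\in \mathrm{dom}(g)\}$ for the orbit of $x\in X$. The orbit $O(x)$ is said to be of \emph{resort type} if there are $g\in\Gamma$ and a nondegenerate interval $[x,p]$ (or $[p,x]$) in $X$ with endpoint $x$, contained in $\mathrm{dom}(g)$ and mapped into itself by $g$, such that $g(x)=x$ and $g^n(q)\to x$ as $n\to\infty$ for every point $q$ of this interval, and such that $O(x)$ contains a point of the open interval between $x$ and $p$. Then at least one of the following holds: 1. there exists a Borel probability measure $\mu$ on $X$ supported on $\Lambda$, i.e. with $\mu(X\setminus\Lambda)=0$, and invariant under all elements of $\Gamma$: $\mu(g(A))=\mu(A)$ for every $g\in\Gamma$ and every Borel set $A\subset\mathrm{dom}(g)$; 2. $\Lambda$ contains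 an orbit of resort type. -/

import Mathlib

open Set Filter Topology MeasureTheory

/-! A pseudogroup of homeomorphisms of a space `X` is a `StructureGroupoid X` which is
`ClosedUnderRestriction`: a family of homeomorphisms between open subsets of `X` that contains the
identity and is closed under composition, inversion, restriction to open subsets and gluing. -/

/-- The orbit `O(x)` of a point under a pseudogroup. -/
def pseudoOrbit {X : Type*} [TopologicalSpace X] (Γ : StructureGroupoid X) (x : X) : Set X :=
  {y | ∃ g ∈ Γ, x ∈ g.source ∧ g x = y}

/-- `K` is invariant: every element of the pseudogroup sends the points of `K` in its domain
into `K`. -/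
def IsPseudoInvariant {X : Type*} [TopologicalSpace X] (Γ : StructureGroupoid X) (K : Set X) :
    Prop :=
  ∀ g ∈ Γ, ∀ x ∈ g.source ∩ K, g x ∈ K

/-- `Λ` is a minimal set: it is minimal for inclusion among the nonempty compact invariant sets. -/
def IsMinimalPseudoInvariant {X : Type*} [TopologicalSpace X] (Γ : StructureGroupoid X)
    (Λ : Set X) : Prop :=
  Minimal (fun K : Set X => IsCompact K ∧ K.Nonempty ∧ IsPseudoInvariant Γ K) Λ

/-- `μ` is invariant under all elements of the pseudogroup: `μ (g A) = μ A` for every Borel set `A`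
contained in the domain of `g`. -/
def IsPseudoInvariantMeasure {X : Type*} [TopologicalSpace X] [MeasurableSpace X]
    (Γ : StructureGroupoid X) (μ : Measure X) : Prop :=
  ∀ g ∈ Γ, ∀ A : Set X, MeasurableSet A → A ⊆ g.source → μ (g '' A) = μ A

/-- The orbit of `x` is of resort type (witnessed at `x`): there is an element `g` of the
pseudogroup, defined on a nondegenerate interval `[x, p]` with endpoint `x` (on either side of `x`;
it is given as the image of an injective path from `x` to `p`), which maps this interval into
itself, fixes `x` and attracts all points of the interval to `x` under iteration; moreover the orbit
of `x` meets the open interval between `x` and `p`. -/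
def IsResortPoint {X : Type*} [TopologicalSpace X] (Γ : StructureGroupoid X) (x : X) : Prop :=
  ∃ (p : X) (γ : Path x p) (g : OpenPartialHomeomorph X X),
    Function.Injective γ ∧ g ∈ Γ ∧ range γ ⊆ g.source ∧ MapsTo g (range γ) (range γ) ∧
    g x = x ∧ (∀ q ∈ range γ, Tendsto (fun n : ℕ => g^[n] q) atTop (𝓝 x)) ∧
    ∃ t : unitInterval, 0 < t ∧ t < 1 ∧ γ t ∈ pseudoOrbit Γ x

/-- `Λ` contains an orbit of resort type. -/
def ContainsResortOrbit {X : Type*} [TopologicalSpace X] (Γ : StructureGroupoid X) (Λ : Set X) :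
    Prop :=
  ∃ x : X, pseudoOrbit Γ x ⊆ Λ ∧ IsResortPoint Γ x

open scoped NNReal ENNReal

/-! Suppose that Λ contains no resort orbit. If Λ is finite, its normalized counting measure is
invariant. If Λ is infinite, take an arc I with one endpoint and one interior point in Λ, and count
disjoint translates of I under Γ.

Dimension one enters through frontiers: every point has arbitrarily small neighbourhoods V with
finite frontier, and at most |∂V| disjoint connected sets can cross V (`card_crossing_le`). Near a
point of Λ choose V so small that some element of Γ carries it into the interior of I. A translate
of I inside V would give a map of I into its own interior, whose iterates, squared if the map
reverses orientation, converge to a resort point. So translates meeting V must cross it, and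
compactness of Λ bounds the size of packings (`exists_card_packing_le`).

Now take a packing P of maximal size and one point of Λ in each member. For g in Γ, replace the
members meeting g(V) by the g-images of those inside V: maximality shows that V holds no more points
than g(V), up to 2|∂V| for crossing members (`card_filter_le_of_maximal`). Short arcs have large
packings (`exists_arc_packing_card_ge`), so after division by |P| the error tends to 0 and a weak
limit of the counting measures is invariant. -/

/-- The half-line model of one-dimensional manifolds with boundary is homeomorphic to `ℝ≥0`. -/
def halfLineHomeomorph : EuclideanHalfSpace 1 ≃ₜ ℝ≥0 where
  toFun z := ⟨z.1 0, z.2⟩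
  invFun t := ⟨WithLp.toLp 2 fun _ => (t : ℝ), t.2⟩
  left_inv z := by
    apply Subtype.ext
    ext i
    rw [Subsingleton.elim i 0]
    rfl
  right_inv t := by
    apply Subtype.ext
    rfl
  continuous_toFun := by
    apply Continuous.subtype_mk
    have h : Continuous fun z : EuclideanSpace ℝ (Fin 1) => z 0 := by fun_prop
    exact h.comp continuous_subtype_val
  continuous_invFun := by
    apply Continuous.subtype_mk
    have h : Continuous fun t : ℝ≥0 => fun _ : Fin 1 => (t : ℝ) := by fun_prop
    exact (PiLp.continuous_toLp 2 _).comp h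

/-! ### Neighbourhoods with finite frontier -/

section Coordinates

variable {X : Type*} [TopologicalSpace X]

theorem exists_coordinate [ChartedSpace (EuclideanHalfSpace 1) X] (x : X) :
    ∃ φ : OpenPartialHomeomorph X ℝ≥0, x ∈ φ.source :=
  ⟨(chartAt (EuclideanHalfSpace 1) x).trans halfLineHomeomorph.toOpenPartialHomeomorph, by
    simp [mem_chart_source]⟩

variable [T2Space X] [ChartedSpace (EuclideanHalfSpace 1) X]

/-- A small ball in a half-line coordinate has at most two boundary points. This is where dimension
one is used. -/
theorem exists_finite_frontier_nhds (x : X) {U : Set X} (hU : U ∈ 𝓝 x) :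
    ∃ V, IsOpen V ∧ x ∈ V ∧ V ⊆ U ∧ (frontier V).Finite := by
  obtain ⟨φ, hx⟩ := exists_coordinate x
  have hN : φ.target ∩ φ.symm ⁻¹' U ∈ 𝓝 (φ x) :=
    inter_mem (φ.open_target.mem_nhds (φ.map_source hx))
      ((φ.tendsto_symm hx) hU)
  obtain ⟨ε, hε, hball⟩ := Metric.nhds_basis_closedBall.mem_iff.1 hN
  have hsub : Metric.ball (φ x) ε ⊆ φ.target := fun t ht =>
    (hball (Metric.ball_subset_closedBall ht)).1
  have hVo : IsOpen (φ.symm '' Metric.ball (φ x) ε) :=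
    φ.symm.isOpen_image_of_subset_source Metric.isOpen_ball hsub
  refine ⟨_, hVo, ⟨φ x, Metric.mem_ball_self hε, φ.left_inv hx⟩, ?_, ?_⟩
  · rintro _ ⟨t, ht, rfl⟩
    exact (hball (Metric.ball_subset_closedBall ht)).2
  · have hcl : closure (φ.symm '' Metric.ball (φ x) ε) ⊆ φ.symm '' Metric.closedBall (φ x) ε := by
      refine closure_minimal (image_mono Metric.ball_subset_closedBall) ?_
      refine ((isCompact_closedBall (φ x) ε).image_of_continuousOn ?_).isClosed
      exact φ.continuousOn_symm.mono fun t ht => (hball ht).1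
    have hfin : (Metric.sphere (φ x) ε).Finite := by
      -- If `φ x - ε` is negative, its truncation to 0 is merely a superfluous candidate.
      refine Set.Finite.subset (Set.toFinite
        {Real.toNNReal (φ x + ε), Real.toNNReal (φ x - ε)}) fun t ht => ?_
      rw [Metric.mem_sphere, NNReal.dist_eq] at ht
      rcases abs_eq hε.le |>.1 ht with h | h
      · left
        rw [show (φ x + ε : ℝ) = t by linarith, Real.toNNReal_coe]
      · right
        rw [mem_singleton_iff, show (φ x - ε : ℝ) = t by linarith, Real.toNNReal_coe]
    refine (hfin.image φ.symm).subset ?_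
    rw [hVo.frontier_eq]
    rintro y ⟨hy, hy'⟩
    obtain ⟨t, ht, rfl⟩ := hcl hy
    refine ⟨t, ?_, rfl⟩
    have h1 : ¬ dist t (φ x) < ε := fun h => hy' ⟨t, h, rfl⟩
    exact le_antisymm ht (not_lt.1 h1)

/-- Finite frontiers survive finite unions, so compactness globalizes the local neighbourhoods.
Regular measures can then be tested on such sets alone. -/
theorem exists_finite_frontier_between [RegularSpace X] {K U : Set X} (hK : IsCompact K)
    (hU : IsOpen U) (hKU : K ⊆ U) :
    ∃ W, IsOpen W ∧ K ⊆ W ∧ closure W ⊆ U ∧ (frontier W).Finite := by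
  refine hK.induction_on (p := fun s => ∃ W, IsOpen W ∧ s ⊆ W ∧ closure W ⊆ U ∧
    (frontier W).Finite) ?_ ?_ ?_ ?_
  · exact ⟨∅, isOpen_empty, Subset.rfl, by simp, by simp⟩
  · rintro s t hst ⟨W, h1, h2, h3⟩
    exact ⟨W, h1, hst.trans h2, h3⟩
  · rintro s t ⟨W, h1, h2, h3, h4⟩ ⟨W', h1', h2', h3', h4'⟩
    refine ⟨W ∪ W', h1.union h1', union_subset_union h2 h2', ?_, ?_⟩
    · rw [closure_union]
      exact union_subset h3 h3'
    · refine (h4.union h4').subset ((frontier_union_subset W W').trans ?_)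
      exact union_subset_union inter_subset_left inter_subset_right
  · intro x hx
    obtain ⟨C, hC, hCc, hCU⟩ := exists_mem_nhds_isClosed_subset (hU.mem_nhds (hKU hx))
    obtain ⟨V, hV, hxV, hVC, hVf⟩ := exists_finite_frontier_nhds x hC
    exact ⟨V, mem_nhdsWithin_of_mem_nhds (hV.mem_nhds hxV), V, hV, Subset.rfl,
      (closure_minimal hVC hCc).trans hCU, hVf⟩

end Coordinates

/-! ### Counting connected sets that cross an open set -/

section Crossing

variable {X : Type*} [TopologicalSpace X]

/-- Among pairwise disjoint connected sets, at most as many cross `V` as `V` has frontier points. -/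
theorem card_crossing_le {P : Finset (Set X)} (hP : (P : Set (Set X)).PairwiseDisjoint id)
    {V : Set X} (hV : (frontier V).Finite)
    (hc : ∀ A ∈ P, IsPreconnected A ∧ (A ∩ V).Nonempty ∧ ¬ A ⊆ V) :
    P.card ≤ (frontier V).ncard := by
  classical
  -- Missing the frontier, `A` would be separated by the interior of `V` and the complement of its
  -- closure.
  have hex : ∀ A ∈ P, (A ∩ frontier V).Nonempty := fun A hA => by
    obtain ⟨h1, h2, h3⟩ := hc A hA
    by_contra hemp
    rw [not_nonempty_iff_eq_empty] at hemp
    have hdis : Disjoint A (frontier V) := disjoint_iff_inter_eq_empty.2 hemp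
    obtain ⟨y, hy, hyV⟩ := h2
    obtain ⟨z, hz, hzV⟩ := not_subset.1 h3
    have hcov : ∀ w ∈ A, w ∈ interior V ∨ w ∉ closure V := fun w hw => by
      by_contra! h
      exact disjoint_left.1 hdis hw ⟨h.2, h.1⟩
    obtain ⟨w, -, hw, hw'⟩ := h1 (interior V) (closure V)ᶜ isOpen_interior
      isClosed_closure.isOpen_compl hcov
      ⟨y, hy, (hcov y hy).resolve_right fun h => h (subset_closure hyV)⟩
      ⟨z, hz, (hcov z hz).resolve_left fun h => hzV (interior_subset h)⟩
    exact hw' (subset_closure (interior_subset hw))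
  rcases P.eq_empty_or_nonempty with rfl | ⟨A₀, hA₀⟩
  · simp
  have : Nonempty X := ⟨(hex A₀ hA₀).some⟩
  choose! p hp using hex
  rw [← Set.ncard_coe_finset P]
  refine Set.ncard_le_ncard_of_injOn p (fun A hA => (hp A hA).2) ?_ hV
  intro A hA B hB hAB
  by_contra hne
  exact disjoint_left.1 (hP hA hB hne) (hp A hA).1 (hAB ▸ (hp B hB).1)

end Crossing

/-! ### Orbits in a minimal set -/

section Orbits

variable {X : Type*} [TopologicalSpace X] {Γ : StructureGroupoid X} {Λ : Set X}

theorem self_mem_pseudoOrbit (Γ : StructureGroupoid X) (x : X) : x ∈ pseudoOrbit Γ x :=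
  ⟨_, Γ.id_mem, mem_univ x, rfl⟩

theorem isPseudoInvariant_pseudoOrbit (Γ : StructureGroupoid X) (x : X) :
    IsPseudoInvariant Γ (pseudoOrbit Γ x) := by
  rintro h hh _ ⟨hs, g, hg, hx, rfl⟩
  exact ⟨g.trans h, Γ.trans hg hh, by simp [hx, hs], rfl⟩

theorem IsPseudoInvariant.closure {K : Set X} (hK : IsPseudoInvariant Γ K) :
    IsPseudoInvariant Γ (closure K) := by
  rintro g hg y ⟨hy, hyK⟩
  rw [mem_closure_iff_frequently] at hyK ⊢
  refine (g.continuousAt hy).tendsto.frequently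
    ((hyK.and_eventually (g.open_source.mem_nhds hy)).mono ?_)
  exact fun z hz => hK g hg z ⟨hz.2, hz.1⟩

theorem IsPseudoInvariant.pseudoOrbit_subset {K : Set X} (hK : IsPseudoInvariant Γ K) {x : X}
    (hx : x ∈ K) : pseudoOrbit Γ x ⊆ K := by
  rintro _ ⟨g, hg, hxg, rfl⟩
  exact hK g hg x ⟨hxg, hx⟩

theorem IsPseudoInvariant.image_mem_iff {K : Set X} (hK : IsPseudoInvariant Γ K)
    {g : OpenPartialHomeomorph X X} (hg : g ∈ Γ) {x : X} (hx : x ∈ g.source) :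
    g x ∈ K ↔ x ∈ K := by
  refine ⟨fun h => ?_, fun h => hK g hg x ⟨hx, h⟩⟩
  have := hK g.symm (Γ.symm hg) (g x) ⟨g.map_source hx, h⟩
  rwa [g.left_inv hx] at this

theorem IsMinimalPseudoInvariant.isCompact (h : IsMinimalPseudoInvariant Γ Λ) : IsCompact Λ :=
  h.1.1

theorem IsMinimalPseudoInvariant.nonempty (h : IsMinimalPseudoInvariant Γ Λ) : Λ.Nonempty :=
  h.1.2.1

theorem IsMinimalPseudoInvariant.invariant (h : IsMinimalPseudoInvariant Γ Λ) :
    IsPseudoInvariant Γ Λ :=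
  h.1.2.2

variable [T2Space X]

theorem IsMinimalPseudoInvariant.subset_closure_pseudoOrbit (h : IsMinimalPseudoInvariant Γ Λ)
    {x : X} (hx : x ∈ Λ) : Λ ⊆ closure (pseudoOrbit Γ x) := by
  have hsub : closure (pseudoOrbit Γ x) ⊆ Λ :=
    closure_minimal (h.invariant.pseudoOrbit_subset hx) h.isCompact.isClosed
  exact h.2 ⟨h.isCompact.of_isClosed_subset isClosed_closure hsub,
    ⟨x, subset_closure (self_mem_pseudoOrbit Γ x)⟩,
    (isPseudoInvariant_pseudoOrbit Γ x).closure⟩ hsub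

theorem IsMinimalPseudoInvariant.exists_mem_orbit (h : IsMinimalPseudoInvariant Γ Λ) {x : X}
    (hx : x ∈ Λ) {U : Set X} (hU : IsOpen U) (hUΛ : (U ∩ Λ).Nonempty) :
    (U ∩ pseudoOrbit Γ x).Nonempty := by
  obtain ⟨y, hyU, hy⟩ := hUΛ
  exact mem_closure_iff.1 (h.subset_closure_pseudoOrbit hx hy) U hU hyU

theorem IsMinimalPseudoInvariant.infinite_pseudoOrbit (h : IsMinimalPseudoInvariant Γ Λ)
    (hinf : Λ.Infinite) {x : X} (hx : x ∈ Λ) : (pseudoOrbit Γ x).Infinite := fun hfin =>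
  hinf (hfin.subset (hfin.isClosed.closure_eq ▸ h.subset_closure_pseudoOrbit hx))

/-- Each point of Λ has a neighbourhood that Γ carries injectively into U. If U ∩ Λ were finite, Λ
would be locally finite, hence finite by compactness. -/
theorem IsMinimalPseudoInvariant.infinite_inter (h : IsMinimalPseudoInvariant Γ Λ)
    (hinf : Λ.Infinite) {U : Set X} (hU : IsOpen U) (hUΛ : (U ∩ Λ).Nonempty) :
    (U ∩ Λ).Infinite := fun hfin => by
  refine hinf ?_
  have key : (Λ ∩ Λ).Finite := h.isCompact.induction_on (p := fun s => (s ∩ Λ).Finite)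
    (by simp) (fun s t hst ht => ht.subset (inter_subset_inter_left _ hst))
    (fun s t hs ht => by rw [union_inter_distrib_right]; exact hs.union ht) ?_
  · rwa [inter_self] at key
  · intro y hy
    obtain ⟨_, hzU, g, hg, hyg, rfl⟩ := h.exists_mem_orbit hy hU hUΛ
    refine ⟨g.source ∩ g ⁻¹' U, mem_nhdsWithin_of_mem_nhds
      ((g.isOpen_inter_preimage hU).mem_nhds ⟨hyg, hzU⟩), ?_⟩
    refine Set.Finite.of_finite_image (f := g) (hfin.subset ?_)
      (g.injOn.mono fun z hz => hz.1.1)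
    rintro _ ⟨z, ⟨⟨hz, hzU⟩, hzΛ⟩, rfl⟩
    exact ⟨hzU, h.invariant g hg z ⟨hz, hzΛ⟩⟩

end Orbits

/-! ### Resort orbits from self-maps of an arc -/

section Resort

variable {X : Type*} [TopologicalSpace X] [T2Space X] {Γ : StructureGroupoid X} {Λ : Set X}

/-- An increasing map of an arc into itself which moves one end `c ∈ Λ` produces an orbit of
resort type. -/
theorem containsResortOrbit_of_strictMonoOn (h : IsMinimalPseudoInvariant Γ Λ)
    (φ : OpenPartialHomeomorph X ℝ≥0) {a c : ℝ≥0} (hac : a < c) (hφ : Icc a c ⊆ φ.target)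
    (hc : φ.symm c ∈ Λ) {f : OpenPartialHomeomorph X X} (hf : f ∈ Γ)
    (hfs : φ.symm '' Icc a c ⊆ f.source) (hmaps : MapsTo f (φ.symm '' Icc a c) (φ.symm '' Icc a c))
    (hmono : StrictMonoOn (fun t => φ (f (φ.symm t))) (Icc a c)) (hlt : φ (f (φ.symm c)) < c) :
    ContainsResortOrbit Γ Λ := by
  set F : ℝ≥0 → ℝ≥0 := fun t => φ (f (φ.symm t)) with hF
  have hcI : c ∈ Icc a c := right_mem_Icc.2 hac.le
  have hFI : ∀ t ∈ Icc a c, F t ∈ Icc a c ∧ φ.symm (F t) = f (φ.symm t) := fun t ht => by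
    obtain ⟨s, hs, hst⟩ := hmaps (mem_image_of_mem _ ht)
    have : F t = s := by simp only [hF, ← hst, φ.right_inv (hφ hs)]
    rw [this]
    exact ⟨hs, hst⟩
  have hFc : ContinuousOn F (Icc a c) := fun t ht => by
    refine ContinuousAt.continuousWithinAt ?_
    have h1 : f (φ.symm t) ∈ φ.source := by
      rw [← (hFI t ht).2]; exact φ.map_target (hφ (hFI t ht).1)
    have h2 : ContinuousAt (fun s => f (φ.symm s)) t :=
      ContinuousAt.comp (f := φ.symm) (f.continuousAt (hfs (mem_image_of_mem _ ht)))
        (φ.continuousAt_symm (hφ ht))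
    exact ContinuousAt.comp (f := fun s => f (φ.symm s)) (φ.continuousAt h1) h2
  have hiter : ∀ n, ∀ t ∈ Icc a c, F^[n] t ∈ Icc a c ∧ φ.symm (F^[n] t) = f^[n] (φ.symm t) := by
    intro n
    induction n with
    | zero => exact fun t ht => ⟨ht, rfl⟩
    | succ n ih =>
      intro t ht
      rw [Function.iterate_succ_apply', Function.iterate_succ_apply']
      refine ⟨(hFI _ (ih t ht).1).1, ?_⟩
      rw [(hFI _ (ih t ht).1).2, (ih t ht).2]
  have hanti : StrictAnti fun n => F^[n] c := strictAnti_nat_of_succ_lt fun n => by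
    induction n with
    | zero => exact hlt
    | succ n ih =>
      calc F^[n + 1 + 1] c = F (F^[n + 1] c) := Function.iterate_succ_apply' F _ c
        _ < F (F^[n] c) := hmono (hiter _ c hcI).1 (hiter _ c hcI).1 ih
        _ = F^[n + 1] c := (Function.iterate_succ_apply' F n c).symm
  -- The limit `z` of the decreasing orbit of `c` is the resort point: it is fixed by continuity and
  -- lies in Λ because Λ is closed.
  obtain ⟨z, hz⟩ : ∃ z, Tendsto (fun n => F^[n] c) atTop (𝓝 z) :=
    ⟨_, tendsto_atTop_ciInf hanti.antitone (OrderBot.bddBelow _)⟩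
  have hzI : z ∈ Icc a c :=
    isClosed_Icc.mem_of_tendsto hz (Eventually.of_forall fun n => (hiter n c hcI).1)
  have hFz : F z = z := by
    have h1 : Tendsto (fun n => F (F^[n] c)) atTop (𝓝 (F z)) :=
      (hFc z hzI).tendsto.comp (tendsto_nhdsWithin_iff.2
        ⟨hz, Eventually.of_forall fun n => (hiter n c hcI).1⟩)
    refine tendsto_nhds_unique h1 ?_
    simpa only [Function.comp_def, Function.iterate_succ_apply'] using
      hz.comp (tendsto_add_atTop_nat 1)
  have hzlt : ∀ n, z < F^[n] c := fun n =>
    (hanti.antitone.le_of_tendsto hz (n + 1)).trans_lt (hanti (Nat.lt_succ_self n))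
  have hzc : z < c := hzlt 0
  have hsub : Icc z c ⊆ Icc a c := Icc_subset_Icc_left hzI.1
  have hzΛ : φ.symm z ∈ Λ := by
    refine h.isCompact.isClosed.mem_of_tendsto
      ((φ.continuousAt_symm (hφ hzI)).tendsto.comp hz) (Eventually.of_forall fun n => ?_)
    simp only [Function.comp_apply, (hiter n c hcI).2]
    induction n with
    | zero => exact hc
    | succ n ih =>
      rw [Function.iterate_succ_apply']
      refine h.invariant f hf _ ⟨?_, ih⟩
      rw [← (hiter n c hcI).2]
      exact hfs (mem_image_of_mem _ (hiter n c hcI).1)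
  -- the arc from `z` to `c`
  have hlmem : ∀ t : unitInterval, z + Real.toNNReal t * (c - z) ∈ Icc z c := fun t => by
    refine ⟨le_self_add, ?_⟩
    calc z + Real.toNNReal t * (c - z) ≤ z + 1 * (c - z) := by
          gcongr
          exact Real.toNNReal_le_one.2 t.2.2
      _ = c := by rw [one_mul, add_tsub_cancel_of_le hzc.le]
  let γ : Path (φ.symm z) (φ.symm c) :=
    { toFun := fun t => φ.symm (z + Real.toNNReal t * (c - z))
      continuous_toFun := by
        refine φ.continuousOn_symm.comp_continuous ?_ fun t => hφ (hsub (hlmem t))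
        have : Continuous fun t : unitInterval => Real.toNNReal t :=
          continuous_real_toNNReal.comp continuous_subtype_val
        fun_prop
      source' := by simp
      target' := by simp [add_tsub_cancel_of_le hzc.le] }
  have hγ : ∀ t, γ t = φ.symm (z + Real.toNNReal t * (c - z)) := fun t => rfl
  have hcz : 0 < c - z := tsub_pos_of_lt hzc
  have hsurj : ∀ s ∈ Icc z c, ∃ t : unitInterval, z + Real.toNNReal t * (c - z) = s := by
    intro s hs
    refine ⟨⟨((s - z) / (c - z) : ℝ≥0), NNReal.coe_nonneg _, ?_⟩, ?_⟩
    · exact_mod_cast div_le_one_of_le₀ (tsub_le_tsub_right hs.2 z) hcz.le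
    · simp only [Real.toNNReal_coe]
      rw [div_mul_cancel₀ _ hcz.ne', add_tsub_cancel_of_le hs.1]
  have hrange : range γ ⊆ φ.symm '' Icc z c := by
    rintro _ ⟨t, rfl⟩
    exact ⟨_, hlmem t, (hγ t).symm⟩
  have hrange' : φ.symm '' Icc z c ⊆ range γ := by
    rintro _ ⟨s, hs, rfl⟩
    obtain ⟨t, ht⟩ := hsurj s hs
    exact ⟨t, by rw [hγ, ht]⟩
  refine ⟨φ.symm z, h.invariant.pseudoOrbit_subset hzΛ, φ.symm c, γ, f, ?_, hf, ?_, ?_, ?_, ?_, ?_⟩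
  · intro s t hst
    rw [hγ, hγ] at hst
    have := φ.symm.injOn (hφ (hsub (hlmem s))) (hφ (hsub (hlmem t))) hst
    have h2 := mul_right_cancel₀ hcz.ne' (add_left_cancel this)
    exact Subtype.ext ((Real.toNNReal_eq_toNNReal_iff s.2.1 t.2.1).1 h2)
  · exact hrange.trans ((image_mono hsub).trans hfs)
  · intro q hq
    obtain ⟨s, hs, rfl⟩ := hrange hq
    refine hrange' ⟨F s, ⟨?_, (hFI s (hsub hs)).1.2⟩, (hFI s (hsub hs)).2⟩
    rw [← hFz]
    exact hmono.monotoneOn hzI (hsub hs) hs.1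
  · rw [← (hFI z hzI).2, hFz]
  · intro q hq
    obtain ⟨s, hs, rfl⟩ := hrange hq
    -- Monotonicity squeezes every orbit between `z` and the orbit of `c`.
    have hsq : Tendsto (fun n => F^[n] s) atTop (𝓝 z) := by
      refine tendsto_of_tendsto_of_tendsto_of_le_of_le tendsto_const_nhds hz (fun n => ?_)
        (fun n => ?_)
      · change z ≤ F^[n] s
        induction n with
        | zero => exact hs.1
        | succ n ih =>
          rw [Function.iterate_succ_apply', ← hFz]
          exact hmono.monotoneOn hzI (hiter n s (hsub hs)).1 ih
      · change F^[n] s ≤ F^[n] c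
        induction n with
        | zero => exact hs.2
        | succ n ih =>
          rw [Function.iterate_succ_apply', Function.iterate_succ_apply']
          exact hmono.monotoneOn (hiter n s (hsub hs)).1 (hiter n c hcI).1 ih
    simpa only [Function.comp_def, fun n => (hiter n s (hsub hs)).2] using
      (φ.continuousAt_symm (hφ hzI)).tendsto.comp hsq
  -- The open arc contains the point of Λ with coordinate `F c`, strictly between `z` and `c`, so
  -- the dense orbit of the fixed point enters it.
  · have hIoo : Ioo z c ⊆ φ.symm.source := fun t ht => hφ (hsub (Ioo_subset_Icc_self ht))
    obtain ⟨_, ⟨s, hs, rfl⟩, hso⟩ := h.exists_mem_orbit hzΛ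
      (φ.symm.isOpen_image_of_subset_source isOpen_Ioo hIoo)
      ⟨φ.symm (F c), ⟨F c, ⟨hzlt 1, hlt⟩, rfl⟩, by
        rw [(hFI c hcI).2]
        exact h.invariant f hf _ ⟨hfs (mem_image_of_mem _ hcI), hc⟩⟩
    obtain ⟨t, rfl⟩ := hsurj s (Ioo_subset_Icc_self hs)
    refine ⟨t, ?_, ?_, hso⟩
    · refine lt_of_le_of_ne t.2.1 fun h0 => hs.1.ne ?_
      simp [← h0]
    · refine lt_of_le_of_ne t.2.2 fun h1 => hs.2.ne ?_
      simp [h1, add_tsub_cancel_of_le hzc.le]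

/-- A map of the pseudogroup sending an arc with endpoints in `Λ` into the interior of the arc
produces an orbit of resort type. -/
theorem containsResortOrbit_of_mapsTo_Ioo (h : IsMinimalPseudoInvariant Γ Λ)
    (φ : OpenPartialHomeomorph X ℝ≥0) {a c : ℝ≥0} (hac : a < c) (hφ : Icc a c ⊆ φ.target)
    (hc : φ.symm c ∈ Λ) {f : OpenPartialHomeomorph X X} (hf : f ∈ Γ)
    (hfs : φ.symm '' Icc a c ⊆ f.source)
    (hmaps : MapsTo f (φ.symm '' Icc a c) (φ.symm '' Ioo a c)) :
    ContainsResortOrbit Γ Λ := by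
  have hmaps' : MapsTo f (φ.symm '' Icc a c) (φ.symm '' Icc a c) :=
    hmaps.mono_right (image_mono Ioo_subset_Icc_self)
  set F : ℝ≥0 → ℝ≥0 := fun t => φ (f (φ.symm t)) with hF
  have hFI : ∀ t ∈ Icc a c, F t ∈ Ioo a c ∧ φ.symm (F t) = f (φ.symm t) := fun t ht => by
    obtain ⟨s, hs, hst⟩ := hmaps (mem_image_of_mem _ ht)
    have : F t = s := by simp only [hF, ← hst, φ.right_inv (hφ (Ioo_subset_Icc_self hs))]
    rw [this]
    exact ⟨hs, hst⟩
  have hFmaps : MapsTo F (Icc a c) (Icc a c) := fun t ht => Ioo_subset_Icc_self (hFI t ht).1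
  have hFc : ContinuousOn F (Icc a c) := fun t ht => by
    refine ContinuousAt.continuousWithinAt ?_
    have h1 : f (φ.symm t) ∈ φ.source := by
      rw [← (hFI t ht).2]; exact φ.map_target (hφ (hFmaps ht))
    have h2 : ContinuousAt (fun s => f (φ.symm s)) t :=
      ContinuousAt.comp (f := φ.symm) (f.continuousAt (hfs (mem_image_of_mem _ ht)))
        (φ.continuousAt_symm (hφ ht))
    exact ContinuousAt.comp (f := fun s => f (φ.symm s)) (φ.continuousAt h1) h2
  have hFinj : InjOn F (Icc a c) := fun s hs t ht hst => by
    have h1 : f (φ.symm s) = f (φ.symm t) := by rw [← (hFI s hs).2, ← (hFI t ht).2, hst]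
    exact φ.symm.injOn (hφ hs) (hφ ht)
      (f.injOn (hfs (mem_image_of_mem _ hs)) (hfs (mem_image_of_mem _ ht)) h1)
  have hcI : c ∈ Icc a c := right_mem_Icc.2 hac.le
  rcases hFc.strictMonoOn_of_injOn_Icc' hac.le hFinj with hm | hm
  · exact containsResortOrbit_of_strictMonoOn h φ hac hφ hc hf hfs hmaps' hm (hFI c hcI).1.2
  -- An orientation-reversing map is replaced by its square, which is increasing and still moves `c`
  -- inward.
  · have hFF : ∀ t ∈ Icc a c, φ ((f.trans f) (φ.symm t)) = F (F t) := fun t ht => by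
      simp only [OpenPartialHomeomorph.coe_trans, Function.comp_apply]
      rw [← (hFI t ht).2]
    refine containsResortOrbit_of_strictMonoOn h φ hac hφ hc (Γ.trans hf hf) ?_ ?_ ?_ ?_
    · intro q hq
      rw [OpenPartialHomeomorph.trans_source]
      exact ⟨hfs hq, hfs (hmaps' hq)⟩
    · exact hmaps'.comp hmaps'
    · intro s hs t ht hst
      simp only [hFF s hs, hFF t ht]
      exact hm (hFmaps ht) (hFmaps hs) (hm hs ht hst)
    · rw [hFF c hcI]
      exact (hFI _ (hFmaps hcI)).1.2

end Resort

/-! ### Packings by disjoint translates of an arc -/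

section Packing

variable {X : Type*} [TopologicalSpace X] {Γ : StructureGroupoid X} {Λ : Set X}

/-- A finite family of pairwise disjoint images of `I` under elements of `Γ` defined on `I`. -/
def IsTranslatePacking (Γ : StructureGroupoid X) (I : Set X) (P : Finset (Set X)) : Prop :=
  (∀ A ∈ P, ∃ g ∈ Γ, I ⊆ g.source ∧ g '' I = A) ∧ (P : Set (Set X)).PairwiseDisjoint id

theorem IsTranslatePacking.subset {I : Set X} {P Q : Finset (Set X)}
    (hP : IsTranslatePacking Γ I P) (hQ : Q ⊆ P) : IsTranslatePacking Γ I Q :=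
  ⟨fun A hA => hP.1 A (hQ hA), hP.2.subset (Finset.coe_subset.2 hQ)⟩

theorem IsTranslatePacking.isPreconnected {I : Set X} {P : Finset (Set X)}
    (hP : IsTranslatePacking Γ I P) (hI : IsPreconnected I) {A : Set X} (hA : A ∈ P) :
    IsPreconnected A := by
  obtain ⟨g, -, hg, rfl⟩ := hP.1 A hA
  exact hI.image g (g.continuousOn.mono hg)

/-- The image of the compact closure of V is closed, so g(V) acquires no boundary points other than
images of those of V. -/
theorem frontier_image_subset [T2Space X] [CompactSpace X] {g : OpenPartialHomeomorph X X}
    {V : Set X} (hV : IsOpen V) (hVg : closure V ⊆ g.source) :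
    frontier (g '' V) ⊆ g '' frontier V := by
  have hcl : closure (g '' V) ⊆ g '' closure V :=
    closure_minimal (image_mono subset_closure)
      (isClosed_closure.isCompact.image_of_continuousOn (g.continuousOn.mono hVg)).isClosed
  rw [(g.isOpen_image_of_subset_source hV (subset_closure.trans hVg)).frontier_eq, hV.frontier_eq]
  rintro y ⟨hy, hyV⟩
  obtain ⟨x, hx, rfl⟩ := hcl hy
  exact ⟨x, ⟨hx, fun h => hyV ⟨x, h, rfl⟩⟩, rfl⟩

open Classical in
/-- The number of points of a maximal packing in `V` is at most the number of them in the image of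
`V`, up to the number of members crossing the boundaries. -/
theorem card_filter_le_of_maximal [T2Space X] [CompactSpace X] {I : Set X}
    (hI : IsPreconnected I) {P : Finset (Set X)}
    (hP : IsTranslatePacking Γ I P)
    (hmax : ∀ Q, IsTranslatePacking Γ I Q → Q.card ≤ P.card) {p : Set X → X}
    (hp : ∀ A ∈ P, p A ∈ A) {g : OpenPartialHomeomorph X X} (hg : g ∈ Γ) {V : Set X}
    (hV : IsOpen V) (hVf : (frontier V).Finite) (hVg : closure V ⊆ g.source) :
    (P.filter fun A => p A ∈ V).card ≤
      (P.filter fun A => p A ∈ g '' V).card + 2 * (frontier V).ncard := by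
  have hVs : V ⊆ g.source := subset_closure.trans hVg
  set W := g '' V with hW
  have hWf : (frontier W).Finite := (hVf.image g).subset (frontier_image_subset hV hVg)
  have hWn : (frontier W).ncard ≤ (frontier V).ncard :=
    (Set.ncard_le_ncard (frontier_image_subset hV hVg) (hVf.image g)).trans
      (Set.ncard_image_le hVf)
  have hcross : ∀ (U : Set X), (frontier U).Finite →
      (P.filter fun A => (A ∩ U).Nonempty ∧ ¬ A ⊆ U).card ≤ (frontier U).ncard := fun U hU => by
    refine card_crossing_le (hP.subset (Finset.filter_subset _ _)).2 hU fun A hA => ?_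
    rw [Finset.mem_filter] at hA
    exact ⟨hP.isPreconnected hI hA.1, hA.2⟩
  have hne : ∀ A ∈ P, A.Nonempty := fun A hA => ⟨_, hp A hA⟩
  have h1 : (P.filter fun A => p A ∈ V).card ≤
      (P.filter fun A => A ⊆ V).card + (frontier V).ncard := by
    refine le_trans ?_ (Nat.add_le_add_left (hcross V hVf) _)
    refine (Finset.card_le_card fun A hA => ?_).trans (Finset.card_union_le _ _)
    rw [Finset.mem_filter] at hA
    by_cases hAV : A ⊆ V
    · exact Finset.mem_union_left _ (Finset.mem_filter.2 ⟨hA.1, hAV⟩)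
    · exact Finset.mem_union_right _ (Finset.mem_filter.2
        ⟨hA.1, ⟨p A, hp A hA.1, hA.2⟩, hAV⟩)
  have h2 : (P.filter fun A => (A ∩ W).Nonempty).card ≤
      (P.filter fun A => p A ∈ W).card + (frontier V).ncard := by
    refine le_trans ?_ (Nat.add_le_add_left ((hcross W hWf).trans hWn) _)
    refine (Finset.card_le_card fun A hA => ?_).trans (Finset.card_union_le _ _)
    rw [Finset.mem_filter] at hA
    by_cases hAV : A ⊆ W
    · exact Finset.mem_union_left _ (Finset.mem_filter.2 ⟨hA.1, hAV (hp A hA.1)⟩)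
    · exact Finset.mem_union_right _ (Finset.mem_filter.2 ⟨hA.1, hA.2, hAV⟩)
  -- The exchange: discard the members meeting `W` and insert the g-images of those inside `V`. The
  -- result is again a packing, so maximality applies.
  have h3 : (P.filter fun A => A ⊆ V).card ≤ (P.filter fun A => (A ∩ W).Nonempty).card := by
    set P₁ := P.filter fun A => A ⊆ V with hP₁
    set P₂ := P.filter fun A => ¬ (A ∩ W).Nonempty with hP₂
    have hinj : InjOn (fun A : Set X => g '' A) (P₁ : Set (Set X)) := by
      intro A hA B hB hAB
      have hA' := (Finset.mem_filter.1 hA).2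
      have hB' := (Finset.mem_filter.1 hB).2
      exact (g.injOn.image_eq_image_iff (hA'.trans hVs) (hB'.trans hVs)).1 hAB
    have hdisj : Disjoint P₂ (P₁.image fun A => g '' A) := by
      rw [Finset.disjoint_left]
      intro B hB hB'
      obtain ⟨A, hA, rfl⟩ := Finset.mem_image.1 hB'
      have hA' := Finset.mem_filter.1 hA
      obtain ⟨x, hx⟩ := hne A hA'.1
      exact (Finset.mem_filter.1 hB).2 ⟨g x, ⟨x, hx, rfl⟩, ⟨x, hA'.2 hx, rfl⟩⟩
    have hQ : IsTranslatePacking Γ I (P₂ ∪ P₁.image fun A => g '' A) := by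
      refine ⟨fun B hB => ?_, ?_⟩
      · rcases Finset.mem_union.1 hB with hB | hB
        · exact hP.1 B (Finset.mem_filter.1 hB).1
        · obtain ⟨A, hA, rfl⟩ := Finset.mem_image.1 hB
          obtain ⟨hAP, hAV⟩ := Finset.mem_filter.1 hA
          obtain ⟨k, hk, hIk, rfl⟩ := hP.1 A hAP
          refine ⟨k.trans g, Γ.trans hk hg, ?_, ?_⟩
          · rw [OpenPartialHomeomorph.trans_source]
            exact fun x hx => ⟨hIk hx, hVs (hAV (mem_image_of_mem k hx))⟩
          · rw [OpenPartialHomeomorph.coe_trans, image_comp]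
      · have hmixed : ∀ B ∈ P₂, ∀ A ∈ P₁, Disjoint B (g '' A) := fun B hB A hA => by
          have hB' := (Finset.mem_filter.1 hB).2
          rw [not_nonempty_iff_eq_empty, ← disjoint_iff_inter_eq_empty] at hB'
          exact hB'.mono_right (image_mono (Finset.mem_filter.1 hA).2)
        intro B hB C hC hBC
        rcases Finset.mem_union.1 (Finset.mem_coe.1 hB) with hB | hB <;>
        rcases Finset.mem_union.1 (Finset.mem_coe.1 hC) with hC | hC
        · exact hP.2 (Finset.mem_filter.1 hB).1 (Finset.mem_filter.1 hC).1 hBC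
        · obtain ⟨A, hA, rfl⟩ := Finset.mem_image.1 hC
          exact hmixed B hB A hA
        · obtain ⟨A, hA, rfl⟩ := Finset.mem_image.1 hB
          exact (hmixed C hC A hA).symm
        · obtain ⟨A, hA, rfl⟩ := Finset.mem_image.1 hB
          obtain ⟨A', hA', rfl⟩ := Finset.mem_image.1 hC
          have hA₁ := Finset.mem_filter.1 hA
          have hA₂ := Finset.mem_filter.1 hA'
          have hAA : A ≠ A' := fun h => hBC (by rw [h])
          have hd : Disjoint A A' := hP.2 hA₁.1 hA₂.1 hAA
          exact (disjoint_image_image fun x hx y hy hxy => disjoint_left.1 hd hx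
            (g.injOn (hVs (hA₁.2 hx)) (hVs (hA₂.2 hy)) hxy ▸ hy))
    have hcard := hmax _ hQ
    rw [Finset.card_union_of_disjoint hdisj, Finset.card_image_of_injOn hinj] at hcard
    have hsplit : (P.filter fun A => (A ∩ W).Nonempty).card + P₂.card = P.card := by
      convert Finset.card_filter_add_card_filter_not (s := P) (fun A => (A ∩ W).Nonempty)
    omega
  omega

variable [T2Space X] [ChartedSpace (EuclideanHalfSpace 1) X]

/-- Without resort orbits, the number of disjoint translates of an arc is bounded. -/
theorem exists_card_packing_le (h : IsMinimalPseudoInvariant Γ Λ)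
    (hno : ¬ ContainsResortOrbit Γ Λ) (φ : OpenPartialHomeomorph X ℝ≥0) {a b c : ℝ≥0}
    (hab : a < b) (hbc : b < c) (hφ : Icc a c ⊆ φ.target) (hb : φ.symm b ∈ Λ)
    (hc : φ.symm c ∈ Λ) :
    ∃ M : ℕ, ∀ P, IsTranslatePacking Γ (φ.symm '' Icc a c) P → P.card ≤ M := by
  classical
  have hac := hab.trans hbc
  have hIpre : IsPreconnected (φ.symm '' Icc a c) :=
    isPreconnected_Icc.image _ (φ.continuousOn_symm.mono hφ)
  -- Relative to a subset of Λ the bound is additive under unions, so compactness reduces it to a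
  -- neighbourhood of one point.
  have key : ∃ M : ℕ, ∀ P, IsTranslatePacking Γ (φ.symm '' Icc a c) P →
      (∀ A ∈ P, (A ∩ Λ).Nonempty) → P.card ≤ M := by
    refine h.isCompact.induction_on (p := fun s => ∃ M : ℕ, ∀ P,
      IsTranslatePacking Γ (φ.symm '' Icc a c) P → (∀ A ∈ P, (A ∩ s).Nonempty) → P.card ≤ M)
      ?_ ?_ ?_ ?_
    · refine ⟨0, fun P _ hP => ?_⟩
      rw [Nat.le_zero, Finset.card_eq_zero, Finset.eq_empty_iff_forall_notMem]
      intro A hA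
      simpa using hP A hA
    · rintro s t hst ⟨M, hM⟩
      exact ⟨M, fun P hP hs => hM P hP fun A hA =>
        (hs A hA).mono (inter_subset_inter_right _ hst)⟩
    · rintro s t ⟨M, hM⟩ ⟨N, hN⟩
      refine ⟨M + N, fun P hP hst => ?_⟩
      rw [← Finset.card_filter_add_card_filter_not (s := P) (fun A => (A ∩ s).Nonempty)]
      refine add_le_add (hM _ (hP.subset (Finset.filter_subset _ _)) fun A hA =>
        (Finset.mem_filter.1 hA).2) (hN _ (hP.subset (Finset.filter_subset _ _)) fun A hA => ?_)
      obtain ⟨hAP, hAs⟩ := Finset.mem_filter.1 hA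
      have := hst A hAP
      rw [inter_union_distrib_left, union_nonempty] at this
      exact this.resolve_left hAs
    · intro y hy
      have hO : IsOpen (φ.symm '' Ioo a c) :=
        φ.symm.isOpen_image_of_subset_source isOpen_Ioo (Ioo_subset_Icc_self.trans hφ)
      obtain ⟨_, hzO, k, hk, hyk, rfl⟩ := h.exists_mem_orbit hy hO
        ⟨φ.symm b, ⟨b, ⟨hab, hbc⟩, rfl⟩, hb⟩
      obtain ⟨V, hV, hyV, hVk, hVf⟩ := exists_finite_frontier_nhds y
        ((k.isOpen_inter_preimage hO).mem_nhds ⟨hyk, hzO⟩)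
      -- A translate inside `V`, followed by `k`, would map the arc into its own interior; hence
      -- every translate meeting `V` crosses it.
      refine ⟨V, mem_nhdsWithin_of_mem_nhds (hV.mem_nhds hyV), (frontier V).ncard,
        fun P hP hPV => card_crossing_le hP.2 hVf fun A hA =>
          ⟨hP.isPreconnected hIpre hA, hPV A hA, fun hAV => hno ?_⟩⟩
      obtain ⟨g, hg, hIg, rfl⟩ := hP.1 A hA
      refine containsResortOrbit_of_mapsTo_Ioo h φ hac hφ hc (Γ.trans hg hk) ?_ ?_
      · rw [OpenPartialHomeomorph.trans_source]
        exact fun x hx => ⟨hIg hx, (hVk (hAV (mem_image_of_mem g hx))).1⟩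
      · exact fun x hx => (hVk (hAV (mem_image_of_mem g hx))).2
  obtain ⟨M, hM⟩ := key
  refine ⟨M, fun P hP => hM P hP fun A hA => ?_⟩
  obtain ⟨g, hg, hIg, rfl⟩ := hP.1 A hA
  have hcI : φ.symm c ∈ φ.symm '' Icc a c := mem_image_of_mem _ (right_mem_Icc.2 hac.le)
  exact ⟨_, mem_image_of_mem g hcI, h.invariant g hg _ ⟨hIg hcI, hc⟩⟩

/-- Small arcs with endpoints in `Λ` have many disjoint translates. -/
theorem exists_arc_packing_card_ge (h : IsMinimalPseudoInvariant Γ Λ) (hinf : Λ.Infinite) (n : ℕ) :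
    ∃ (φ : OpenPartialHomeomorph X ℝ≥0) (a b c : ℝ≥0), a < b ∧ b < c ∧ Icc a c ⊆ φ.target ∧
      φ.symm b ∈ Λ ∧ φ.symm c ∈ Λ ∧
      ∃ P, IsTranslatePacking Γ (φ.symm '' Icc a c) P ∧ n ≤ P.card := by
  classical
  obtain ⟨x, hx⟩ := h.nonempty
  obtain ⟨T, hT, hTn⟩ := (h.infinite_pseudoOrbit hinf hx).exists_subset_card_eq n
  have hTg : ∀ y ∈ T, ∃ g ∈ Γ, x ∈ g.source ∧ g x = y := fun y hy => hT hy
  have : Nonempty (OpenPartialHomeomorph X X) := ⟨.refl X⟩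
  choose! g hg hxg hgx using hTg
  -- Elements of Γ send x to n distinct orbit points; an arc near x is then sent into n disjoint
  -- open sets.
  obtain ⟨D, hD, hDdisj⟩ := T.finite_toSet.t2_separation
  have hN : (⋂ y ∈ T, (g y).source ∩ g y ⁻¹' D y) ∈ 𝓝 x := by
    refine (Filter.biInter_finset_mem T).2 fun y hy => ?_
    refine ((g y).isOpen_inter_preimage (hD y).2).mem_nhds ⟨hxg y hy, ?_⟩
    rw [mem_preimage, hgx y hy]
    exact (hD y).1
  obtain ⟨φ, hφx⟩ := exists_coordinate x
  have hN' : φ.target ∩ φ.symm ⁻¹' (⋂ y ∈ T, (g y).source ∩ g y ⁻¹' D y) ∈ 𝓝 (φ x) :=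
    inter_mem (φ.open_target.mem_nhds (φ.map_source hφx)) (φ.tendsto_symm hφx hN)
  obtain ⟨J, ⟨hJ, hJord⟩, hJsub⟩ : ∃ J, (J ∈ 𝓝 (φ x) ∧ OrdConnected J) ∧
      J ⊆ φ.target ∩ φ.symm ⁻¹' (⋂ y ∈ T, (g y).source ∩ g y ⁻¹' D y) := by
    obtain ⟨ε, hε, hball⟩ := Metric.nhds_basis_ball.mem_iff.1 hN'
    refine ⟨_, ⟨Metric.ball_mem_nhds _ hε, ?_⟩, hball⟩
    refine ⟨fun s hs t ht u hu => ?_⟩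
    rw [Metric.mem_ball, NNReal.dist_eq, abs_lt] at hs ht ⊢
    have h1 : (s : ℝ) ≤ u := hu.1
    have h2 : (u : ℝ) ≤ t := hu.2
    constructor <;> linarith
  have hJtarget : interior J ⊆ φ.target := interior_subset.trans fun t ht => (hJsub ht).1
  have hinfJ : (φ.symm '' interior J ∩ Λ).Infinite :=
    h.infinite_inter hinf (φ.symm.isOpen_image_of_subset_source isOpen_interior hJtarget)
      ⟨x, ⟨φ x, mem_interior_iff_mem_nhds.2 hJ, φ.left_inv hφx⟩, hx⟩
  have hinfJ' : {t | t ∈ J ∧ φ.symm t ∈ Λ}.Infinite := by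
    refine Set.Infinite.of_image φ.symm (hinfJ.mono ?_)
    rintro _ ⟨⟨t, ht, rfl⟩, htΛ⟩
    exact ⟨t, ⟨interior_subset ht, htΛ⟩, rfl⟩
  -- The middle point `b` ensures that the open arc meets Λ, as the packing bound requires.
  obtain ⟨a, b, c, ha, hb, hc, hab, hbc⟩ : ∃ a b c : ℝ≥0, (a ∈ J ∧ φ.symm a ∈ Λ) ∧
      (b ∈ J ∧ φ.symm b ∈ Λ) ∧ (c ∈ J ∧ φ.symm c ∈ Λ) ∧ a < b ∧ b < c := by
    obtain ⟨s, hs, hs3⟩ := hinfJ'.exists_subset_card_eq 3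
    let e := s.orderEmbOfFin hs3
    exact ⟨e 0, e 1, e 2, hs (s.orderEmbOfFin_mem hs3 0), hs (s.orderEmbOfFin_mem hs3 1),
      hs (s.orderEmbOfFin_mem hs3 2), e.strictMono (by decide), e.strictMono (by decide)⟩
  have hIJ : Icc a c ⊆ J := hJord.out ha.1 hc.1
  have hIg : ∀ y ∈ T, φ.symm '' Icc a c ⊆ (g y).source ∩ g y ⁻¹' D y := by
    rintro y hy _ ⟨t, ht, rfl⟩
    have := (hJsub (hIJ ht)).2
    rw [mem_preimage, mem_iInter₂] at this
    exact this y hy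
  have hcI : φ.symm c ∈ φ.symm '' Icc a c :=
    mem_image_of_mem _ (right_mem_Icc.2 (hab.trans hbc).le)
  have hdis : ∀ y ∈ T, ∀ z ∈ T, y ≠ z →
      Disjoint (g y '' (φ.symm '' Icc a c)) (g z '' (φ.symm '' Icc a c)) := fun y hy z hz hyz =>
    (hDdisj hy hz hyz).mono (image_subset_iff.2 fun u hu => (hIg y hy hu).2)
      (image_subset_iff.2 fun u hu => (hIg z hz hu).2)
  refine ⟨φ, a, b, c, hab, hbc, fun t ht => (hJsub (hIJ ht)).1, hb.2, hc.2,
    T.image fun y => g y '' (φ.symm '' Icc a c), ⟨?_, ?_⟩, ?_⟩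
  · intro A hA
    obtain ⟨y, hy, rfl⟩ := Finset.mem_image.1 hA
    exact ⟨g y, hg y hy, fun u hu => (hIg y hy hu).1, rfl⟩
  · intro A hA B hB hAB
    obtain ⟨y, hy, rfl⟩ := Finset.mem_image.1 (Finset.mem_coe.1 hA)
    obtain ⟨z, hz, rfl⟩ := Finset.mem_image.1 (Finset.mem_coe.1 hB)
    exact hdis y hy z hz fun h => hAB (by rw [h])
  · rw [Finset.card_image_of_injOn, hTn]
    intro y hy z hz hyz
    by_contra hne
    have := hdis y hy z hz hne
    simp only at hyz
    rw [hyz] at this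
    exact disjoint_left.1 this (mem_image_of_mem _ hcI) (mem_image_of_mem _ hcI)

end Packing

/-! ### Almost invariant measures and their limits -/

section Measures

variable {X : Type*} [TopologicalSpace X] [T2Space X] [MeasurableSpace X]
  {Γ : StructureGroupoid X} {Λ : Set X}

/-- The normalized counting measure of a finite invariant set is invariant. -/
theorem exists_invariant_measure_of_finite [BorelSpace X]
    (h : IsMinimalPseudoInvariant Γ Λ) (hfin : Λ.Finite) :
    ∃ μ : Measure X, IsProbabilityMeasure μ ∧ μ Λᶜ = 0 ∧ IsPseudoInvariantMeasure Γ μ := by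
  refine ⟨ProbabilityTheory.uniformOn Λ,
    ProbabilityTheory.isProbabilityMeasure_uniformOn hfin h.nonempty, ?_, ?_⟩
  · rw [ProbabilityTheory.uniformOn_eq_zero_iff hfin, inter_compl_self]
  · intro g hg A _ hA
    have himg : Λ ∩ g '' A = g '' (Λ ∩ A) := by
      ext y
      constructor
      · rintro ⟨hy, x, hx, rfl⟩
        exact ⟨x, ⟨(h.invariant.image_mem_iff hg (hA hx)).1 hy, hx⟩, rfl⟩
      · rintro ⟨x, ⟨hx, hxA⟩, rfl⟩
        exact ⟨h.invariant g hg x ⟨hA hxA, hx⟩, x, hxA, rfl⟩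
    rw [ProbabilityTheory.uniformOn, ProbabilityTheory.cond_apply hfin.measurableSet,
      ProbabilityTheory.cond_apply hfin.measurableSet, himg,
      Measure.count_apply ((hfin.subset inter_subset_left).image g).measurableSet,
      Measure.count_apply (hfin.subset inter_subset_left).measurableSet,
      (g.injOn.mono (inter_subset_right.trans hA)).encard_image]

variable [CompactSpace X] [ChartedSpace (EuclideanHalfSpace 1) X]

/-- A measure which does not decrease on small open sets is invariant. -/
theorem isPseudoInvariantMeasure_of_le {μ : Measure X} [IsFiniteMeasure μ]
    [μ.Regular]
    (hμ : ∀ g ∈ Γ, ∀ V : Set X, IsOpen V → (frontier V).Finite → closure V ⊆ g.source →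
      μ V ≤ μ (g '' closure V)) : IsPseudoInvariantMeasure Γ μ := by
  -- Inner regularity, with a finite-frontier set inserted between a compact set and `U`. Applying
  -- this to inverses then gives equality on open sets.
  have hopen : ∀ g ∈ Γ, ∀ U : Set X, IsOpen U → U ⊆ g.source → μ U ≤ μ (g '' U) := by
    intro g hg U hU hUg
    rw [hU.measure_eq_iSup_isCompact μ]
    refine iSup₂_le fun K hKU => iSup_le fun hK => ?_
    obtain ⟨W, hW, hKW, hWU, hWf⟩ := exists_finite_frontier_between hK hU hKU
    exact (measure_mono hKW).trans ((hμ g hg W hW hWf (hWU.trans hUg)).trans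
      (measure_mono (image_mono hWU)))
  have hopen' : ∀ g ∈ Γ, ∀ U : Set X, IsOpen U → U ⊆ g.source → μ (g '' U) = μ U := by
    intro g hg U hU hUg
    refine le_antisymm ?_ (hopen g hg U hU hUg)
    have := hopen g.symm (Γ.symm hg) (g '' U) (g.isOpen_image_of_subset_source hU hUg)
      (by rintro _ ⟨x, hx, rfl⟩; exact g.map_source (hUg hx))
    rwa [(g.leftInvOn.mono hUg).image_image] at this
  -- Outer regularity passes from open sets to arbitrary ones.
  have hle : ∀ g ∈ Γ, ∀ A : Set X, A ⊆ g.source → μ (g '' A) ≤ μ A := by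
    intro g hg A hA
    conv_rhs => rw [A.measure_eq_iInf_isOpen μ]
    refine le_iInf₂ fun U hAU => le_iInf fun hU => ?_
    calc μ (g '' A) ≤ μ (g '' (g.source ∩ U)) :=
          measure_mono (image_mono (subset_inter hA hAU))
      _ = μ (g.source ∩ U) := hopen' g hg _ (g.open_source.inter hU) inter_subset_left
      _ ≤ μ U := measure_mono inter_subset_right
  intro g hg A _ hA
  refine le_antisymm (hle g hg A hA) ?_
  have := hle g.symm (Γ.symm hg) (g '' A)
    (by rintro _ ⟨x, hx, rfl⟩; exact g.map_source (hA hx))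
  rwa [(g.leftInvOn.mono hA).image_image] at this

variable [BorelSpace X]

/-- A limit of asymptotically invariant probability measures is invariant. -/
theorem exists_invariant_measure_of_asymptotic (hΛ : IsClosed Λ) (ν : ℕ → ProbabilityMeasure X)
    (hν : ∀ n, (ν n : Measure X) Λᶜ = 0)
    (hinv : ∀ g ∈ Γ, ∀ V : Set X, IsOpen V → (frontier V).Finite → closure V ⊆ g.source →
      ∃ C : ℝ≥0∞, C ≠ ⊤ ∧ ∀ n : ℕ, (ν n : Measure X) V ≤
        (ν n : Measure X) (g '' V) + C * (n + 1 : ℝ≥0∞)⁻¹) :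
    ∃ μ : Measure X, IsProbabilityMeasure μ ∧ μ Λᶜ = 0 ∧ IsPseudoInvariantMeasure Γ μ := by
  have : SecondCountableTopology (EuclideanHalfSpace 1) :=
    halfLineHomeomorph.secondCountableTopology
  have : SecondCountableTopology X :=
    ChartedSpace.secondCountable_of_sigmaCompact (EuclideanHalfSpace 1) X
  let _ : MetricSpace X := TopologicalSpace.metrizableSpaceMetric X
  obtain ⟨μ, hμ⟩ := exists_clusterPt_of_compactSpace (map ν atTop)
  -- Along an ultrafilter all the sequences of masses needed below converge, with no dependence on
  -- `g` or `V`.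
  obtain ⟨L, hL, hlim⟩ := mapClusterPt_iff_ultrafilter.1 hμ
  refine ⟨μ, inferInstance, ?_, isPseudoInvariantMeasure_of_le ?_⟩
  · have := ProbabilityMeasure.le_liminf_measure_open_of_tendsto hlim hΛ.isOpen_compl
    simpa [hν] using this
  · intro g hg V hV hVf hVg
    obtain ⟨C, hC, hle⟩ := hinv g hg V hV hVf hVg
    have hclosed : IsClosed (g '' closure V) :=
      (isClosed_closure.isCompact.image_of_continuousOn (g.continuousOn.mono hVg)).isClosed
    -- Weak limits bound open sets from above by the liminf and closed sets from below by the
    -- limsup, hence the passage from `g '' V` to `g '' closure V`.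
    have h1 := ProbabilityMeasure.le_liminf_measure_open_of_tendsto hlim hV
    have h2 := ProbabilityMeasure.limsup_measure_closed_le_of_tendsto hlim hclosed
    have hconv : ∀ u : ℕ → ℝ≥0∞, ∃ l, Tendsto u L (𝓝 l) := fun u =>
      ⟨_, (Ultrafilter.le_nhds_lim (L.map u))⟩
    obtain ⟨α, hα⟩ := hconv fun n => (ν n : Measure X) V
    obtain ⟨β, hβ⟩ := hconv fun n => (ν n : Measure X) (g '' closure V)
    rw [hα.liminf_eq] at h1
    rw [hβ.limsup_eq] at h2
    have h0 : Tendsto (fun n : ℕ => C * (n + 1 : ℝ≥0∞)⁻¹) L (𝓝 0) := by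
      have : Tendsto (fun n : ℕ => C * (n + 1 : ℝ≥0∞)⁻¹) atTop (𝓝 (C * 0)) := by
        refine ENNReal.Tendsto.const_mul ?_ (Or.inr hC)
        have := ENNReal.tendsto_inv_nat_nhds_zero.comp (tendsto_add_atTop_nat 1)
        simpa [Function.comp_def] using this
      rw [mul_zero] at this
      exact this.mono_left hL
    have h3 : α ≤ β + 0 := le_of_tendsto_of_tendsto' hα (hβ.add h0) fun n =>
      (hle n).trans (add_le_add_left (measure_mono (image_mono subset_closure)) _)
    rw [add_zero] at h3
    exact h1.trans (h3.trans h2)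

open Classical in
/-- Without resort orbits, an infinite minimal set carries almost invariant measures. -/
theorem exists_asymptotic_measure (h : IsMinimalPseudoInvariant Γ Λ) (hinf : Λ.Infinite)
    (hno : ¬ ContainsResortOrbit Γ Λ) (n : ℕ) :
    ∃ ν : ProbabilityMeasure X, (ν : Measure X) Λᶜ = 0 ∧
      ∀ g ∈ Γ, ∀ V : Set X, IsOpen V → (frontier V).Finite → closure V ⊆ g.source →
        (ν : Measure X) V ≤
          (ν : Measure X) (g '' V) + (2 * (frontier V).ncard : ℕ) * (n + 1 : ℝ≥0∞)⁻¹ := by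
  obtain ⟨φ, a, b, c, hab, hbc, hφ, hb, hc, P₀, hP₀, hcard₀⟩ :=
    exists_arc_packing_card_ge h hinf (n + 1)
  set I := φ.symm '' Icc a c with hI
  obtain ⟨M, hM⟩ := exists_card_packing_le h hno φ hab hbc hφ hb hc
  obtain ⟨P, hP, hmax⟩ : ∃ P, IsTranslatePacking Γ I P ∧
      ∀ Q, IsTranslatePacking Γ I Q → Q.card ≤ P.card := by
    -- Sizes of packings are bounded, so the largest one is attained.
    let s : Set ℕ := {k | ∃ P, IsTranslatePacking Γ I P ∧ P.card = k}
    have hs : BddAbove s := ⟨M, by rintro _ ⟨P, hP, rfl⟩; exact hM P hP⟩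
    obtain ⟨P, hP, hPs⟩ := Nat.sSup_mem (s := s) ⟨_, P₀, hP₀, rfl⟩ hs
    exact ⟨P, hP, fun Q hQ => hPs ▸ le_csSup hs ⟨Q, hQ, rfl⟩⟩
  have hcard : n + 1 ≤ P.card := hcard₀.trans (hmax P₀ hP₀)
  have hcI : φ.symm c ∈ I := mem_image_of_mem _ (right_mem_Icc.2 (hab.trans hbc).le)
  have hIpre : IsPreconnected I := isPreconnected_Icc.image _ (φ.continuousOn_symm.mono hφ)
  have hpt : ∀ A ∈ P, ∃ y, y ∈ A ∧ y ∈ Λ := fun A hA => by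
    obtain ⟨g, hg, hIg, rfl⟩ := hP.1 A hA
    exact ⟨_, mem_image_of_mem g hcI, h.invariant g hg _ ⟨hIg hcI, hc⟩⟩
  have : Nonempty X := ⟨φ.symm c⟩
  choose! p hpA hpΛ using hpt
  have hP0 : (P.card : ℝ≥0∞) ≠ 0 := by
    rw [Nat.cast_ne_zero]
    omega
  let m : Measure X := (P.card : ℝ≥0∞)⁻¹ • ∑ A ∈ P, Measure.dirac (p A)
  have hm : ∀ V : Set X, MeasurableSet V →
      m V = (P.card : ℝ≥0∞)⁻¹ * (P.filter fun A => p A ∈ V).card := fun V hV => by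
    simp only [m, Measure.smul_apply, Measure.finsetSum_apply, Measure.dirac_apply' _ hV,
      smul_eq_mul, indicator_apply, Pi.one_apply, Finset.sum_boole]
  have hprob : IsProbabilityMeasure m := ⟨by
    rw [hm _ MeasurableSet.univ]
    simp [ENNReal.inv_mul_cancel hP0 (ENNReal.natCast_ne_top _)]⟩
  refine ⟨⟨m, hprob⟩, ?_, fun g hg V hV hVf hVg => ?_⟩
  · change m Λᶜ = 0
    have hzero : ∀ A ∈ P, Measure.dirac (p A) Λᶜ = 0 := fun A hA => by
      rw [Measure.dirac_apply' _ h.isCompact.isClosed.isOpen_compl.measurableSet,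
        indicator_of_notMem (not_not.2 (hpΛ A hA))]
    rw [Measure.smul_apply, Measure.finsetSum_apply, Finset.sum_eq_zero hzero, smul_zero]
  · change m V ≤ m (g '' V) + _
    have hgV : IsOpen (g '' V) := g.isOpen_image_of_subset_source hV (subset_closure.trans hVg)
    rw [hm _ hV.measurableSet, hm _ hgV.measurableSet]
    have hle : ((P.filter fun A => p A ∈ V).card : ℝ≥0∞) ≤
        (P.filter fun A => p A ∈ g '' V).card + (2 * (frontier V).ncard : ℕ) := by
      exact_mod_cast card_filter_le_of_maximal hIpre hP hmax hpA hg hV hVf hVg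
    -- At least n + 1 members turn the fixed crossing error into one of order 1/(n + 1).
    have hinv : (P.card : ℝ≥0∞)⁻¹ ≤ (n + 1 : ℝ≥0∞)⁻¹ :=
      ENNReal.inv_le_inv.2 (by exact_mod_cast hcard)
    calc (P.card : ℝ≥0∞)⁻¹ * (P.filter fun A => p A ∈ V).card
        ≤ (P.card : ℝ≥0∞)⁻¹ *
          ((P.filter fun A => p A ∈ g '' V).card + (2 * (frontier V).ncard : ℕ)) := by gcongr
      _ = (P.card : ℝ≥0∞)⁻¹ * (P.filter fun A => p A ∈ g '' V).card +
          (2 * (frontier V).ncard : ℕ) * (P.card : ℝ≥0∞)⁻¹ := by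
        rw [mul_add, mul_comm _ ((2 * (frontier V).ncard : ℕ) : ℝ≥0∞)]
      _ ≤ _ := by gcongr

end Measures

/- Charts in the half-line `EuclideanHalfSpace 1` make `X` a one-dimensional manifold with possibly
empty boundary. -/
theorem mainTheorem10 {X : Type*} [TopologicalSpace X] [T2Space X] [CompactSpace X]
    [ChartedSpace (EuclideanHalfSpace 1) X] [MeasurableSpace X] [BorelSpace X]
    (Γ : StructureGroupoid X) [ClosedUnderRestriction Γ]
    (Λ : Set X) (hΛ : IsMinimalPseudoInvariant Γ Λ) :
    (∃ μ : Measure X, IsProbabilityMeasure μ ∧ μ Λᶜ = 0 ∧ IsPseudoInvariantMeasure Γ μ) ∨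
      ContainsResortOrbit Γ Λ := by
  by_cases hno : ContainsResortOrbit Γ Λ
  · exact Or.inr hno
  left
  rcases Λ.finite_or_infinite with hfin | hinf
  · exact exists_invariant_measure_of_finite hΛ hfin
  · choose ν hν hinv using exists_asymptotic_measure hΛ hinf hno
    exact exists_invariant_measure_of_asymptotic hΛ.isCompact.isClosed ν hν
      fun g hg V hV hVf hVg => ⟨_, ENNReal.natCast_ne_top _, fun n => hinv n g hg V hV hVf hVg⟩
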